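/- Identify $2^\omega$ (the set of functions $\omega\to\{0,1\}$ with the product topology) with the set of languages $L\subseteq\{0,1\}^{*}$ through any fixed bijective enumeration $s_0,s_1,\dots$ of the strings, where $A\in 2^\omega$ corresponds to $\{s_n : A(n)=1\}$. Call a set $C\subseteq 2^\omega$ $\boldsymbol\Sigma^0_2$ if it is a countable union of closed sets, $\boldsymbol\Pi^0_2$ if it is a countable intersection of open sets, and $\boldsymbol\Sigma^0_2$-complete if it is $\boldsymbol\Sigma^0_2$, is not $\boldsymbol\Pi^0_2$, and every $\boldsymbol\Sigma^0_2$ set $B\subseteq 2^\omega$ is of the form $B=f^{-1}(C)$ for a continuous $f:2^\omega\to 2^\omega$. Theorem. Each of the complexity classes $\mathbf{P}$, $\mathbf{NP}$, $\mathbf{EXP}$, $\mathbf{coNP}$, $\mathbf{BQP}$, $\mathbf{PH}$, $\mathbf{L}$, $\mathbf{NL}$ and $\mathbf{PSPACE}$ of languages over $\{0,1\}$, viewed as a subset of $2^\omega$, is $\boldsymbol\Sigma^0_2$-complete. Here $\mathbf{P}$, $\mathbf{NP}$, $\mathbf{EXP}$, $\mathbf{PSPACE}$, $\mathbf{L}$,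 $\mathbf{NL}$ are defined by deterministic or nondeterministic Turing machines (with a read-only input tape and a work tape) that halt on every computation path, with time or work-space bounds $n^{O(1)}$, $n^{O(1)}$, $2^{n^{O(1)}}$ (time) and $n^{O(1)}$, $O(\log n)$, $O(\log n)$ (space), respectively; $\mathbf{coNP}$ consists of the complements of languages in $\mathbf{NP}$; $\mathbf{PH}$ consists of the languages definable by $\exists x_1\forall x_2\cdots Qx_l\,R(x_1,\dots,x_l,y)$ with $R$ a polynomial-time relation and the quantifiers ranging over strings of length at most a fixed polynomial in $|y|$; and $\mathbf{BQP}$ consists of the languages accepted with probability at least $2/3$ by a polynomial-time quantum Turing machine of Bernstein and Vazirani, whose time evolution is unitary and whose transition amplitudes have polynomial-time computable real and imaginary parts. -/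

import Mathlib

namespace Complexity

/-! ### The second level of the Borel hierarchy -/

/-- `A` is (boldface) `Σ⁰₂`: a countable union of closed sets. -/
def IsSigma02 {X : Type*} [TopologicalSpace X] (A : Set X) : Prop :=
  ∃ F : ℕ → Set X, (∀ n, IsClosed (F n)) ∧ A = ⋃ n, F n

/-- `A` is (boldface) `Π⁰₂`: a countable intersection of open sets. -/
def IsPi02 {X : Type*} [TopologicalSpace X] (A : Set X) : Prop :=
  ∃ U : ℕ → Set X, (∀ n, IsOpen (U n)) ∧ A = ⋂ n, U n

/-- `A ⊆ 2^ω` is `Σ⁰₂`-complete: it is `Σ⁰₂`, it is not `Π⁰₂`, and every `Σ⁰₂` subset of `2^ω`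
is the preimage of `A` under a continuous map `2^ω → 2^ω`. -/
def IsSigma02Complete (A : Set (ℕ → Bool)) : Prop :=
  IsSigma02 A ∧ ¬ IsPi02 A ∧
    ∀ B : Set (ℕ → Bool), IsSigma02 B → ∃ f : (ℕ → Bool) → (ℕ → Bool), Continuous f ∧ f ⁻¹' A = B

/-! ### Strings and languages -/

/-- Strings over the alphabet `{0, 1}` (`false` is `0`, `true` is `1`). -/
abbrev Str := List Bool

/-- Languages: sets of strings. -/
abbrev Lang := Set Str

/-- Given an enumeration `e 0, e 1, …` of all strings, the set of points of `2^ω` that are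
characteristic functions of the languages in the class `C`. -/
def asSubset (e : ℕ ≃ Str) (C : Set Lang) : Set (ℕ → Bool) :=
  {A | {w : Str | A (e.symm w) = true} ∈ C}

/-- The content of cell `i` when `x` is written in the cells `0, …, |x| - 1` of an otherwise blank
two-way infinite tape (`none` is the blank). -/
def inputCell (x : Str) (i : ℤ) : Option Bool :=
  if 0 ≤ i then x[i.toNat]? else none

/-! ### Classical Turing machines -/

/-- A work tape symbol: the blank `none`, a bit, or one of `m` further symbols. -/
abbrev Sym (m : ℕ) := Option (Bool ⊕ Fin m)

/-- A (nondeterministic) Turing machine with a two-way read-only input tape and a two-way infinite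
work tape. The states are `Fin (states + 1)`, with start state `0`. The set `δ q b s` consists of
the actions available in state `q` when the input head reads `b` and the work head reads `s`; an
action gives the new state, the symbol written on the work tape, and the moves of the input head
and of the work head (each `-1`, `0` or `1`). The machine halts when no action is available. -/
structure TM where
  states : ℕ
  symbols : ℕ
  accept : Finset (Fin (states + 1))
  δ : Fin (states + 1) → Option Bool → Sym symbols →
    Finset (Fin (states + 1) × Sym symbols × SignType × SignType)

namespace TM

/-- A configuration of `M` (on a fixed input, which is not stored). -/
@[ext] structure Cfg (M : TM) where
  state : Fin (M.states + 1)
  inPos : ℤ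
  tape : ℤ → Sym M.symbols
  pos : ℤ

/-- At most one action is ever available. -/
def Deterministic (M : TM) : Prop :=
  ∀ q b s, (M.δ q b s).card ≤ 1

/-- The initial configuration: start state, input head on the first input cell, blank work tape. -/
def init (M : TM) : M.Cfg :=
  ⟨0, 0, fun _ => none, 0⟩

/-- The result of an action. The input head is confined to the cells `-1, 0, …, |x|`, that is, to
the input and the two blanks that delimit it; a move that would leave this range has no effect. -/
def act (M : TM) (x : Str) (c : M.Cfg)
    (a : Fin (M.states + 1) × Sym M.symbols × SignType × SignType) : M.Cfg :=
  ⟨a.1, max (-1) (min (x.length : ℤ) (c.inPos + (a.2.2.1 : ℤ))),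
    Function.update c.tape c.pos a.2.1, c.pos + (a.2.2.2 : ℤ)⟩

/-- The actions available in a configuration on input `x`. -/
def actions (M : TM) (x : Str) (c : M.Cfg) :
    Finset (Fin (M.states + 1) × Sym M.symbols × SignType × SignType) :=
  M.δ c.state (inputCell x c.inPos) (c.tape c.pos)

/-- `M` on input `x` can be in configuration `c` after exactly `t` steps. -/
def ReachesIn (M : TM) (x : Str) : ℕ → M.Cfg → Prop
  | 0, c => c = M.init
  | t + 1, c => ∃ c₀, M.ReachesIn x t c₀ ∧ ∃ a ∈ M.actions x c₀, c = M.act x c₀ a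

/-- `c` is a halting configuration on input `x`. -/
def Halted (M : TM) (x : Str) (c : M.Cfg) : Prop :=
  M.actions x c = ∅

/-- Some computation of `M` on `x` halts in an accepting state. -/
def Accepts (M : TM) (x : Str) : Prop :=
  ∃ t c, M.ReachesIn x t c ∧ M.Halted x c ∧ c.state ∈ M.accept

/-- Every computation of `M` on `x` halts after at most `T` steps. -/
def HaltsWithin (M : TM) (x : Str) (T : ℕ) : Prop :=
  ∀ t c, M.ReachesIn x t c → t ≤ T

/-- Every computation of `M` on `x` stays within the work tape cells `-S, …, S`. -/
def SpaceWithin (M : TM) (x : Str) (S : ℕ) : Prop :=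
  ∀ t c, M.ReachesIn x t c → |c.pos| ≤ (S : ℤ)

/-- All computations of `M` halt, on an input of length `n` after at most `T n` steps. -/
def RunsInTime (M : TM) (T : ℕ → ℕ) : Prop :=
  ∀ x, M.HaltsWithin x (T x.length)

/-- All computations of `M` halt, and on an input of length `n` they stay within the work tape
cells `-S n, …, S n`. -/
def RunsInSpace (M : TM) (S : ℕ → ℕ) : Prop :=
  ∀ x, (∃ T, M.HaltsWithin x T) ∧ M.SpaceWithin x (S x.length)

/-- The language of the strings that `M` accepts. -/
def language (M : TM) : Lang :=
  {x | M.Accepts x}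

/-- `M` on `x` can halt with `w` written on its work tape in the cells `0, …, |w| - 1`, followed by
a blank. -/
def Outputs (M : TM) (x w : Str) : Prop :=
  ∃ t c, M.ReachesIn x t c ∧ M.Halted x c ∧
    ∀ i : ℕ, i ≤ w.length → c.tape i = (w[i]?).map Sum.inl

end TM

/-! ### Classical complexity classes -/

/-- Languages decided by a deterministic machine in time `T`. -/
def DTIME (T : ℕ → ℕ) : Set Lang :=
  {A | ∃ M : TM, M.Deterministic ∧ M.RunsInTime T ∧ M.language = A}

/-- Languages decided by a nondeterministic machine in time `T`. -/
def NTIME (T : ℕ → ℕ) : Set Lang :=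
  {A | ∃ M : TM, M.RunsInTime T ∧ M.language = A}

/-- Languages decided by a deterministic machine in space `S`. -/
def DSPACE (S : ℕ → ℕ) : Set Lang :=
  {A | ∃ M : TM, M.Deterministic ∧ M.RunsInSpace S ∧ M.language = A}

/-- Languages decided by a nondeterministic machine in space `S`. -/
def NSPACE (S : ℕ → ℕ) : Set Lang :=
  {A | ∃ M : TM, M.RunsInSpace S ∧ M.language = A}

/-- `P`. -/
def ClassP : Set Lang := ⋃ p : Polynomial ℕ, DTIME (fun n => p.eval n)

/-- `NP`. -/
def ClassNP : Set Lang := ⋃ p : Polynomial ℕ, NTIME (fun n => p.eval n)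

/-- `EXP`. -/
def ClassEXP : Set Lang := ⋃ p : Polynomial ℕ, DTIME (fun n => 2 ^ p.eval n)

/-- `co-NP`. -/
def ClassCoNP : Set Lang := {A | Aᶜ ∈ ClassNP}

/-- `L`. -/
def ClassL : Set Lang := ⋃ c : ℕ, DSPACE (fun n => c * (Nat.log 2 n + 1))

/-- `NL`. -/
def ClassNL : Set Lang := ⋃ c : ℕ, NSPACE (fun n => c * (Nat.log 2 n + 1))

/-- `PSPACE`. -/
def ClassPSPACE : Set Lang := ⋃ p : Polynomial ℕ, DSPACE (fun n => p.eval n)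

/-- A string coding a finite sequence of strings: every bit `b` is replaced by `1b`, and every
string is terminated by `0`. -/
def encodeTuple (xs : List Str) : Str :=
  xs.flatMap fun w => w.flatMap (fun b => [true, b]) ++ [false]

/-- The alternating quantification `Q x₁, Q' x₂, …` (`l` quantifiers over strings of length at most
`m`, the first one existential if the Boolean is `true` and universal otherwise) of the
relation `R [x₁, …, xₗ]`. -/
def AltQuant (m : ℕ) : ℕ → Bool → (List Str → Prop) → Prop
  | 0, _, R => R []
  | l + 1, true, R => ∃ x : Str, x.length ≤ m ∧ AltQuant m l false fun xs => R (x :: xs)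
  | l + 1, false, R => ∀ x : Str, x.length ≤ m → AltQuant m l true fun xs => R (x :: xs)

/-- `PH`: languages defined by an expression `∃ x₁ ∀ x₂ … Q xₗ R(x₁, …, xₗ, y)`, with `R` a
polynomial time relation and quantifiers over strings of length polynomially bounded in `|y|`. -/
def ClassPH : Set Lang :=
  {A | ∃ (l : ℕ) (p : Polynomial ℕ), ∃ R ∈ ClassP, ∀ y : Str,
    y ∈ A ↔ AltQuant (p.eval y.length) l true fun xs => encodeTuple (xs ++ [y]) ∈ R}

/-! ### Efficiently computable complex numbers -/

/-- The integer coded by a string: a sign bit (`1` is minus), then binary digits with the least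
significant one first. -/
def strToInt : Str → ℤ
  | [] => 0
  | s :: w => (if s then -1 else 1) * (Nat.ofDigits 2 (w.map Bool.toNat) : ℤ)

/-- `r` is a polynomial time computable real: some deterministic polynomial time machine, on
input `1ⁿ`, outputs an integer `k` with `|r - k / 2ⁿ| ≤ 2⁻ⁿ`. -/
def PolyTimeReal (r : ℝ) : Prop :=
  ∃ (M : TM) (p : Polynomial ℕ), M.Deterministic ∧ M.RunsInTime (fun n => p.eval n) ∧
    ∀ n : ℕ, ∃ w, M.Outputs (List.replicate n true) w ∧
      |r - (strToInt w : ℝ) / 2 ^ n| ≤ 1 / 2 ^ n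

/-- The real and imaginary parts of `z` are polynomial time computable. -/
def PolyTimeComplex (z : ℂ) : Prop :=
  PolyTimeReal z.re ∧ PolyTimeReal z.im

/-! ### Quantum Turing machines -/

/-- The transition table of a quantum Turing machine with one two-way infinite tape. The states are
`Fin (states + 2)`, with start state `0` and halting state `1`; `δ q s (q', s', d)` is the amplitude
of going from state `q`, reading `s`, to state `q'`, writing `s'` and moving the head by
`d = ±1`. -/
structure QTM where
  states : ℕ
  symbols : ℕ
  δ : Fin (states + 2) → Sym symbols → Fin (states + 2) × Sym symbols × ℤˣ → ℂ
  efficient : ∀ q s a, PolyTimeComplex (δ q s a)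

namespace QTM

/-- A tape content: a function on the cells that is blank off a finite set. -/
abbrev Tape (m : ℕ) := {t : ℤ → Sym m // {i | t i ≠ none}.Finite}

/-- Write `s` in cell `i`. -/
def Tape.write {m : ℕ} (t : Tape m) (i : ℤ) (s : Sym m) : Tape m :=
  ⟨Function.update t.1 i s, (t.2.insert i).subset fun j hj => by
    by_cases h : j = i
    · exact Or.inl h
    · exact Or.inr (by simpa [Function.update_of_ne h] using hj)⟩

/-- The tape with the string `x` in the cells `0, …, |x| - 1`. -/
def Tape.ofStr {m : ℕ} (x : Str) : Tape m :=
  ⟨fun i => (inputCell x i).map Sum.inl,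
    (Set.finite_Icc (0 : ℤ) x.length).subset fun i hi => by
      by_cases h : 0 ≤ i
      · refine ⟨h, ?_⟩
        by_contra hlt
        simp [inputCell, h] at hi
        omega
      · simp [inputCell, h] at hi⟩

/-- A configuration of `M`. -/
@[ext] structure Cfg (M : QTM) where
  state : Fin (M.states + 2)
  tape : Tape M.symbols
  pos : ℤ

/-- A superposition: a finite linear combination of configurations. -/
abbrev Superposition (M : QTM) := M.Cfg →₀ ℂ

/-- The configuration that results from an action. -/
def act (M : QTM) (c : M.Cfg) (a : Fin (M.states + 2) × Sym M.symbols × ℤˣ) : M.Cfg :=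
  ⟨a.1, c.tape.write c.pos a.2.1, c.pos + (a.2.2 : ℤ)⟩

/-- The linear time evolution operator. -/
noncomputable def evolve (M : QTM) : M.Superposition →ₗ[ℂ] M.Superposition :=
  Finsupp.linearCombination ℂ fun c : M.Cfg =>
    ∑ a, Finsupp.single (M.act c a) (M.δ c.state (c.tape.1 c.pos) a)

/-- The squared Euclidean length of a superposition. -/
noncomputable def normSq {M : QTM} (ψ : M.Superposition) : ℝ :=
  ∑ c ∈ ψ.support, ‖ψ c‖ ^ 2

/-- The time evolution operator is unitary: it preserves the Euclidean length and is onto. (It and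
its adjoint map finite superpositions to finite ones, so this is the same as unitarity of its
extension to the Hilbert space with the configurations as an orthonormal basis.) -/
def Unitary (M : QTM) : Prop :=
  (∀ ψ : M.Superposition, normSq (M.evolve ψ) = normSq ψ) ∧ Function.Surjective M.evolve

/-- The superposition of `M` on input `x` after `t` steps. -/
noncomputable def superposition (M : QTM) (x : Str) (t : ℕ) : M.Superposition :=
  (M.evolve)^[t] (Finsupp.single ⟨0, Tape.ofStr x, 0⟩ 1)

/-- `M` on input `x` halts in `T` steps: after `T` steps all configurations in the superposition
are halting, and no halting configuration occurs in the superposition before. -/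
def HaltsIn (M : QTM) (x : Str) (T : ℕ) : Prop :=
  (∀ c ∈ (M.superposition x T).support, c.state = 1) ∧
    ∀ t < T, ∀ c ∈ (M.superposition x t).support, c.state ≠ 1

open Classical in
/-- The probability of observing the bit `b` in the start cell in the superposition `ψ`. -/
noncomputable def probBit {M : QTM} (ψ : M.Superposition) (b : Bool) : ℝ :=
  ∑ c ∈ ψ.support with c.tape.1 0 = some (Sum.inl b), ‖ψ c‖ ^ 2

end QTM

/-- `BQP`: languages for which some quantum Turing machine with unitary time evolution halts on
every input `x` after at most `p |x|` steps, for a polynomial `p`, and then shows in its start cell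
only `0` or `1`, namely `1` with probability at least `2/3` if `x` is in the language, and `0` with
probability at least `2/3` if it is not. -/
def ClassBQP : Set Lang :=
  {A | ∃ (M : QTM) (p : Polynomial ℕ), M.Unitary ∧ ∀ x : Str, ∃ T ≤ p.eval x.length,
    M.HaltsIn x T ∧
    QTM.probBit (M.superposition x T) true + QTM.probBit (M.superposition x T) false = 1 ∧
    (x ∈ A → 2 / 3 ≤ QTM.probBit (M.superposition x T) true) ∧
    (x ∉ A → 2 / 3 ≤ QTM.probBit (M.superposition x T) false)}

end Complexity

open PiNat

namespace Complexity

/-! ### Countable dense subsets of the Cantor space -/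

/-! Two properties of a class suffice (`isSigma02Complete_asSubset`): it is countable, and it
contains every finite language. Countability makes it `Σ⁰₂`. Finite languages make it dense, and a
countable dense subset of `2^ω` is not `Π⁰₂` by Baire.

For hardness, let `a 0, a 1, …` enumerate the class and let `B` be the union of closed sets `F n`.
Read `x` digit by digit, holding one `F n` at a time and passing to the next when the digits read
exclude the current one. Output `0`, except that at the moment `m` when `F n` is discarded the
output is the opposite of `a n m`. If `x ∈ B`, only finitely many sets are discarded and the output
is eventually `0`, hence in the class. Otherwise every `F n` is discarded and the output differs
from every `a n`.

Countability holds because a language is determined by its machine, or for `PH` by countable data.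
For `BQP` it rests on there being only countably many polynomial time computable amplitudes. Finite
languages are regular, which settles the machine classes and `coNP`; `PH` needs no quantifiers. For
`BQP`, a reversible machine scans a fixed window of the tape, and its evolution permutes the
configurations, so it is unitary. -/

theorem exists_cylinder_subset {U : Set (ℕ → Bool)} (hU : IsOpen U) {x : ℕ → Bool} (hx : x ∈ U) :
    ∃ n, cylinder x n ⊆ U := by
  obtain ⟨V, ⟨y, n, rfl⟩, hxV, hV⟩ :=
    (isTopologicalBasis_cylinders (fun _ : ℕ => Bool)).exists_subset_of_mem_open hx hU
  exact ⟨n, by rwa [mem_cylinder_iff_eq.1 hxV]⟩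

theorem not_isOpen_singleton (a : ℕ → Bool) : ¬ IsOpen {a} := by
  intro h
  obtain ⟨n, hn⟩ := exists_cylinder_subset h rfl
  have := congrFun (hn (update_mem_cylinder a n (!a n))) n
  simp at this

theorem dense_of_eventually_false_mem {C : Set (ℕ → Bool)}
    (hC : ∀ a : ℕ → Bool, (∃ N, ∀ n ≥ N, a n = false) → a ∈ C) : Dense C := by
  rw [dense_iff_inter_open]
  rintro U hU ⟨x, hx⟩
  obtain ⟨n, hn⟩ := exists_cylinder_subset hU hx
  refine ⟨fun i => if i < n then x i else false, hn ?_, hC _ ⟨n, fun i hi => ?_⟩⟩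
  · rw [mem_cylinder_iff]
    intro i hi
    simp [hi]
  · simp [not_lt.2 hi]

theorem IsSigma02.of_countable {C : Set (ℕ → Bool)} (hC : C.Countable) : IsSigma02 C := by
  rcases C.eq_empty_or_nonempty with rfl | hne
  · exact ⟨fun _ => ∅, fun _ => isClosed_empty, by simp⟩
  · obtain ⟨a, rfl⟩ := hC.exists_eq_range hne
    exact ⟨fun n => {a n}, fun n => isClosed_singleton, by ext; simp [eq_comm]⟩

/-- Baire category: each `U n` contains the dense set `C`, and removing the point `a n` keeps it
open and dense since `2^ω` has no isolated points. The intersection is nonempty, yet it would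
consist of points of `C` different from every `a n`. -/
theorem not_isPi02_of_countable_of_dense {C : Set (ℕ → Bool)} (hC : C.Countable)
    (hd : Dense C) : ¬ IsPi02 C := by
  rintro ⟨U, hU, hCU⟩
  obtain ⟨a, ha⟩ := hC.exists_eq_range hd.nonempty
  have hdense : Dense (⋂ n, U n ∩ {a n}ᶜ) := by
    refine dense_iInter_of_isOpen (fun n => (hU n).inter isOpen_compl_singleton) fun n => ?_
    refine Dense.inter_of_isOpen_left (hd.mono ?_) ?_ (hU n)
    · rw [hCU]
      exact Set.iInter_subset U n
    · exact dense_compl_singleton_iff_not_open.2 (not_isOpen_singleton _)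
  obtain ⟨x, hx⟩ := hdense.nonempty
  rw [Set.mem_iInter] at hx
  have hxC : x ∈ C := hCU ▸ Set.mem_iInter.2 fun n => (hx n).1
  rw [ha] at hxC
  obtain ⟨n, rfl⟩ := hxC
  exact (hx n).2 rfl

/-! ### Reduction of a `Σ⁰₂` set to a countable set -/

/-- The point `x` is seen to be outside `F` from its first `m` digits. -/
def Leaves (F : Set (ℕ → Bool)) (x : ℕ → Bool) (m : ℕ) : Prop :=
  Disjoint (cylinder x m) F

open Classical in
/-- The number of the sets `F 0, F 1, …` discarded, one after the other, in `m` steps. -/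
noncomputable def discarded (F : ℕ → Set (ℕ → Bool)) (x : ℕ → Bool) : ℕ → ℕ
  | 0 => 0
  | m + 1 => if Leaves (F (discarded F x m)) x m then discarded F x m + 1 else discarded F x m

open Classical in
/-- The sequence that avoids `a n` when `F n` is discarded, and is constantly `false` otherwise. -/
noncomputable def avoid (F : ℕ → Set (ℕ → Bool)) (a : ℕ → ℕ → Bool) (x : ℕ → Bool) (m : ℕ) : Bool :=
  if Leaves (F (discarded F x m)) x m then !a (discarded F x m) m else false

theorem leaves_congr {F : Set (ℕ → Bool)} {x y : ℕ → Bool} {m : ℕ} (h : y ∈ cylinder x m) :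
    Leaves F y m ↔ Leaves F x m := by
  rw [Leaves, Leaves, mem_cylinder_iff_eq.1 h]

/-- The counter at time `m` has consulted only cylinders of length less than `m`. Hence the `m`-th
output depends on the first `m` digits alone, which gives continuity of `avoid`. -/
theorem discarded_congr {F : ℕ → Set (ℕ → Bool)} {x y : ℕ → Bool} {m : ℕ}
    (h : y ∈ cylinder x m) : discarded F y m = discarded F x m := by
  induction m with
  | zero => rfl
  | succ m ih =>
    have h' := cylinder_anti x m.le_succ h
    rw [discarded, discarded, ih h']
    classical exact if_congr (leaves_congr h') rfl rfl

theorem continuous_avoid (F : ℕ → Set (ℕ → Bool)) (a : ℕ → ℕ → Bool) :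
    Continuous (avoid F a) := by
  refine continuous_pi fun m => IsLocallyConstant.continuous ?_
  rw [IsLocallyConstant.iff_exists_open]
  refine fun x => ⟨cylinder x m, isOpen_cylinder _ x m, self_mem_cylinder x m, fun y hy => ?_⟩
  rw [avoid, avoid, discarded_congr hy]
  classical exact if_congr (leaves_congr hy) rfl rfl

theorem discarded_mono (F : ℕ → Set (ℕ → Bool)) (x : ℕ → Bool) : Monotone (discarded F x) := by
  refine monotone_nat_of_le_succ fun m => ?_
  rw [discarded]
  split_ifs <;> omega

/-- A set containing `x` meets all cylinders around `x` and is never discarded, so the counter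
cannot pass `n`. -/
theorem discarded_le {F : ℕ → Set (ℕ → Bool)} {x : ℕ → Bool} {n : ℕ} (hx : x ∈ F n) (m : ℕ) :
    discarded F x m ≤ n := by
  induction m with
  | zero => exact n.zero_le
  | succ m ih =>
    rw [discarded]
    split_ifs with h
    · refine lt_of_le_of_ne ih fun heq => ?_
      rw [heq] at h
      exact Set.disjoint_left.1 h (self_mem_cylinder x m) hx
    · exact ih

theorem avoid_eventually_false {F : ℕ → Set (ℕ → Bool)} (a : ℕ → ℕ → Bool) {x : ℕ → Bool} {n : ℕ}
    (hx : x ∈ F n) : ∃ N, ∀ m ≥ N, avoid F a x m = false := by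
  obtain ⟨N, hN⟩ : ∃ N, ∀ m ≥ N, discarded F x m = discarded F x N := by
    have hfin : (Set.range (discarded F x)).Finite :=
      (Set.finite_Iic n).subset (Set.range_subset_iff.2 (discarded_le hx))
    obtain ⟨_, ⟨N, rfl⟩, hN⟩ := hfin.exists_maximal (Set.range_nonempty _)
    exact ⟨N, fun m hm => le_antisymm (hN ⟨m, rfl⟩ (discarded_mono F x hm)) (discarded_mono F x hm)⟩
  -- A discard at time `m ≥ N` would increase a counter that is already constant.
  refine ⟨N, fun m hm => if_neg fun h => ?_⟩
  have h1 := hN (m + 1) (by omega)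
  rw [discarded, if_pos h, hN m hm] at h1
  omega

theorem exists_leaves {F : Set (ℕ → Bool)} (hF : IsClosed F) {x : ℕ → Bool} (hx : x ∉ F) :
    ∃ N, ∀ m ≥ N, Leaves F x m := by
  obtain ⟨N, hN⟩ := exists_cylinder_subset hF.isOpen_compl hx
  exact ⟨N, fun m hm => Set.disjoint_left.2 fun y hy => hN (cylinder_anti x hm hy)⟩

/-- The counter cannot stall at `n`: since `F n` is closed and misses `x`, all sufficiently long
cylinders around `x` miss it. This is used twice, to reach the value `n` and to find the moment at
which `F n` goes. -/
theorem exists_discards {F : ℕ → Set (ℕ → Bool)} (hF : ∀ n, IsClosed (F n)) {x : ℕ → Bool}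
    (hx : ∀ n, x ∉ F n) (n : ℕ) : ∃ m, discarded F x m = n ∧ Leaves (F n) x m := by
  have hreach : ∃ m, discarded F x m = n := by
    induction n with
    | zero => exact ⟨0, rfl⟩
    | succ n ih =>
      by_contra! hne
      obtain ⟨m, hm⟩ := ih
      have hconst : ∀ k, discarded F x (m + k) = n := by
        intro k
        induction k with
        | zero => exact hm
        | succ k ihk =>
          have := hne (m + k + 1)
          rw [← add_assoc]
          rw [discarded, ihk] at this ⊢
          split_ifs at this ⊢ <;> simp_all
      obtain ⟨N, hN⟩ := exists_leaves (hF n) (hx n)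
      refine hne (m + N + 1) ?_
      rw [discarded, hconst, if_pos (hN _ (by omega))]
  by_contra! hne
  obtain ⟨m, hm⟩ := hreach
  have hconst : ∀ k, discarded F x (m + k) = n := by
    intro k
    induction k with
    | zero => exact hm
    | succ k ihk =>
      rw [← add_assoc, discarded, ihk, if_neg (hne _ ihk)]
  obtain ⟨N, hN⟩ := exists_leaves (hF n) (hx n)
  exact hne _ (hconst N) (hN _ (by omega))

/-- A countable subset of `2^ω` that contains all eventually zero sequences is
`Σ⁰₂`-complete. -/
theorem IsSigma02Complete.of_countable {C : Set (ℕ → Bool)} (hC : C.Countable)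
    (hfin : ∀ a : ℕ → Bool, (∃ N, ∀ n ≥ N, a n = false) → a ∈ C) : IsSigma02Complete C := by
  have hd := dense_of_eventually_false_mem hfin
  refine ⟨.of_countable hC, not_isPi02_of_countable_of_dense hC hd, ?_⟩
  rintro B ⟨F, hF, rfl⟩
  obtain ⟨a, ha⟩ := hC.exists_eq_range hd.nonempty
  refine ⟨avoid F a, continuous_avoid F a, Set.ext fun x => ⟨fun hx => ?_, fun hx => ?_⟩⟩
  · by_contra hxF
    rw [Set.mem_iUnion, not_exists] at hxF
    rw [Set.mem_preimage, ha] at hx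
    obtain ⟨n, hn⟩ := hx
    obtain ⟨m, hm, hl⟩ := exists_discards hF hxF n
    have := congrFun hn m
    rw [avoid, hm, if_pos hl] at this
    simp at this
  · obtain ⟨n, hn⟩ := Set.mem_iUnion.1 hx
    exact hfin _ (avoid_eventually_false a hn)

/-- A countable class of languages that contains all finite languages is `Σ⁰₂`-complete. -/
theorem isSigma02Complete_asSubset (e : ℕ ≃ Str) {C : Set Lang} (hC : C.Countable)
    (hfin : ∀ A : Lang, A.Finite → A ∈ C) : IsSigma02Complete (asSubset e C) := by
  refine .of_countable (hC.preimage_of_injOn (Function.Injective.injOn ?_)) ?_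
  · intro A B hAB
    funext n
    have := Set.ext_iff.1 hAB (e n)
    simpa using this
  · rintro a ⟨N, hN⟩
    -- A sequence vanishing from `N` on codes a subset of `{e 0, …, e (N - 1)}`.
    refine hfin _ (((Set.finite_Iio N).image e).subset fun w hw => ⟨e.symm w, ?_, by simp⟩)
    by_contra hlt
    have := hN _ (not_lt.1 hlt)
    simp_all

/-! ### Countability of the classes -/

instance : Countable TM :=
  Function.Surjective.countable
    (f := fun d : Σ n m : ℕ, Finset (Fin (n + 1)) × (Fin (n + 1) → Option Bool → Sym m →
      Finset (Fin (n + 1) × Sym m × SignType × SignType)) => TM.mk d.1 d.2.1 d.2.2.1 d.2.2.2)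
    fun M => ⟨⟨M.states, M.symbols, M.accept, M.δ⟩, rfl⟩

theorem countable_of_subset_range_language {C : Set Lang} (h : C ⊆ Set.range TM.language) :
    C.Countable :=
  (Set.countable_range _).mono h

theorem countable_classP : ClassP.Countable :=
  countable_of_subset_range_language <| Set.iUnion_subset fun _ _ ⟨M, _, _, hM⟩ => ⟨M, hM⟩

theorem countable_classNP : ClassNP.Countable :=
  countable_of_subset_range_language <| Set.iUnion_subset fun _ _ ⟨M, _, hM⟩ => ⟨M, hM⟩

theorem countable_classEXP : ClassEXP.Countable :=
  countable_of_subset_range_language <| Set.iUnion_subset fun _ _ ⟨M, _, _, hM⟩ => ⟨M, hM⟩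

theorem countable_classL : ClassL.Countable :=
  countable_of_subset_range_language <| Set.iUnion_subset fun _ _ ⟨M, _, _, hM⟩ => ⟨M, hM⟩

theorem countable_classNL : ClassNL.Countable :=
  countable_of_subset_range_language <| Set.iUnion_subset fun _ _ ⟨M, _, hM⟩ => ⟨M, hM⟩

theorem countable_classPSPACE : ClassPSPACE.Countable :=
  countable_of_subset_range_language <| Set.iUnion_subset fun _ _ ⟨M, _, _, hM⟩ => ⟨M, hM⟩

theorem countable_classCoNP : ClassCoNP.Countable :=
  countable_classNP.preimage_of_injOn compl_injective.injOn

theorem countable_polynomial_nat : Countable (Polynomial ℕ) := by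
  rw [← Cardinal.mk_le_aleph0_iff]
  exact Polynomial.cardinalMk_le_max.trans (by simp)

theorem countable_classPH : ClassPH.Countable := by
  have := countable_polynomial_nat
  have := countable_classP.to_subtype
  refine (Set.countable_range fun d : ℕ × Polynomial ℕ × ClassP => {y : Str |
    AltQuant (d.2.1.eval y.length) d.1 true fun xs => encodeTuple (xs ++ [y]) ∈ d.2.2.1}).mono ?_
  rintro A ⟨l, p, R, hR, hA⟩
  exact ⟨(l, p, ⟨R, hR⟩), Set.ext fun y => (hA y).symm⟩

/-! ### Determinism and uniqueness of outputs -/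

namespace TM

variable {M : TM} {x : Str}

theorem Deterministic.reachesIn_unique (hM : M.Deterministic) {t : ℕ} {c c' : M.Cfg}
    (h : M.ReachesIn x t c) (h' : M.ReachesIn x t c') : c = c' := by
  induction t generalizing c c' with
  | zero => exact Eq.trans h (Eq.symm h')
  | succ t ih =>
    obtain ⟨d, hd, a, ha, rfl⟩ := h
    obtain ⟨d', hd', a', ha', rfl⟩ := h'
    obtain rfl := ih hd hd'
    rw [Finset.card_le_one.1 (hM _ _ _) a ha a' ha']

theorem ReachesIn.exists_of_le {t s : ℕ} {c : M.Cfg} (h : M.ReachesIn x t c) (hs : s ≤ t) :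
    ∃ d, M.ReachesIn x s d := by
  induction t generalizing c with
  | zero => exact ⟨c, by rwa [Nat.le_zero.1 hs]⟩
  | succ t ih =>
    rcases hs.eq_or_lt with rfl | hlt
    · exact ⟨c, h⟩
    · obtain ⟨d, hd, -⟩ := h
      exact ih hd (Nat.lt_succ_iff.1 hlt)

theorem Deterministic.le_of_halted (hM : M.Deterministic) {t t' : ℕ} {c c' : M.Cfg}
    (h : M.ReachesIn x t c) (hc : M.Halted x c) (h' : M.ReachesIn x t' c') : t' ≤ t := by
  by_contra! hlt
  obtain ⟨d, e, he, a, ha, -⟩ := h'.exists_of_le (Nat.succ_le_of_lt hlt)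
  rw [← hM.reachesIn_unique h he, hc] at ha
  simp at ha

theorem Deterministic.halted_unique (hM : M.Deterministic) {t t' : ℕ} {c c' : M.Cfg}
    (h : M.ReachesIn x t c) (hc : M.Halted x c) (h' : M.ReachesIn x t' c')
    (hc' : M.Halted x c') : c = c' := by
  obtain rfl := le_antisymm (hM.le_of_halted h' hc' h) (hM.le_of_halted h hc h')
  exact hM.reachesIn_unique h h'

theorem Deterministic.outputs_unique (hM : M.Deterministic) {w w' : Str} (h : M.Outputs x w)
    (h' : M.Outputs x w') : w = w' := by
  obtain ⟨t, c, hr, hc, hw⟩ := h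
  obtain ⟨t', c', hr', hc', hw'⟩ := h'
  obtain rfl := hM.halted_unique hr hc hr' hc'
  -- The blank required after the word fixes its length: the longer word would have a bit in that
  -- cell.
  have hle : w.length = w'.length := by
    rcases lt_trichotomy w.length w'.length with hlt | heq | hlt
    · have := (hw _ le_rfl).symm.trans (hw' _ hlt.le)
      simp [hlt] at this
    · exact heq
    · have := (hw' _ le_rfl).symm.trans (hw _ hlt.le)
      simp [hlt] at this
  refine List.ext_getElem? fun i => ?_
  rcases le_or_gt i w.length with hi | hi
  · exact Option.map_injective Sum.inl_injective ((hw i hi).symm.trans (hw' i (hle ▸ hi)))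
  · rw [List.getElem?_eq_none hi.le, List.getElem?_eq_none (hle ▸ hi.le)]

end TM

/-! ### Countability of the amplitudes and of `BQP` -/

theorem eq_of_forall_abs_sub_le {r s : ℝ} {k : ℕ → ℝ} (hr : ∀ n : ℕ, |r - k n| ≤ 1 / 2 ^ n)
    (hs : ∀ n : ℕ, |s - k n| ≤ 1 / 2 ^ n) : r = s := by
  have hlim : Filter.Tendsto (fun n : ℕ => (1 : ℝ) / 2 ^ n) Filter.atTop (nhds 0) := by
    simpa using tendsto_pow_atTop_nhds_zero_of_lt_one (r := (1 / 2 : ℝ)) (by norm_num) (by norm_num)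
  have key : ∀ {u : ℝ}, (∀ n : ℕ, |u - k n| ≤ 1 / 2 ^ n) →
      Filter.Tendsto k Filter.atTop (nhds u) := by
    intro u hu
    rw [tendsto_iff_dist_tendsto_zero]
    refine squeeze_zero (fun _ => dist_nonneg) (fun n => ?_) hlim
    rw [dist_comm, Real.dist_eq]
    exact hu n
  exact tendsto_nhds_unique (key hr) (key hs)

/-- A deterministic machine has at most one output on each `1ⁿ`, and these approximations converge
to the real. So a choice of machine for each real is injective. -/
theorem countable_polyTimeReal : {r : ℝ | PolyTimeReal r}.Countable := by
  choose M p hdet _ hout using fun r : {r : ℝ | PolyTimeReal r} => r.2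
  refine Set.countable_coe_iff.1 (Function.Injective.countable (f := M) fun r s hrs => ?_)
  choose v hv hv' using hout r
  choose w hw hw' using hout s
  have hvw : v = w := funext fun n => (hdet r).outputs_unique (hv n) (hrs ▸ hw n)
  exact Subtype.ext (eq_of_forall_abs_sub_le hv' (hvw ▸ hw'))

theorem countable_polyTimeComplex : {z : ℂ | PolyTimeComplex z}.Countable := by
  refine Set.Countable.mono ?_ ((countable_polyTimeReal.prod countable_polyTimeReal).preimage_of_injOn
    Complex.equivRealProd.injective.injOn)
  exact fun z hz => hz

instance : Countable QTM := by
  have : Countable {z : ℂ // PolyTimeComplex z} := countable_polyTimeComplex.to_subtype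
  have (n m : ℕ) : Countable (Fin (n + 2) → Sym m → Fin (n + 2) × Sym m × ℤˣ →
    {z : ℂ // PolyTimeComplex z}) := inferInstance
  exact Function.Surjective.countable
    (f := fun d : Σ n m : ℕ, (Fin (n + 2) → Sym m → Fin (n + 2) × Sym m × ℤˣ →
      {z : ℂ // PolyTimeComplex z}) =>
        QTM.mk d.1 d.2.1 (fun q s a => d.2.2 q s a) fun q s a => (d.2.2 q s a).2)
    fun M => ⟨⟨M.states, M.symbols, fun q s a => ⟨M.δ q s a, M.efficient q s a⟩⟩, rfl⟩

theorem QTM.HaltsIn.not_lt {M : QTM} {x : Str} {T T' : ℕ} (h : M.HaltsIn x T)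
    (h' : M.HaltsIn x T') (hne : M.superposition x T ≠ 0) : ¬ T < T' := by
  intro hlt
  obtain ⟨c, hc⟩ := Finsupp.support_nonempty_iff.2 hne
  exact h'.2 T hlt c hc (h.1 c hc)

/-- Nonvanishing makes the halting time unique: a zero superposition has empty support and would
count vacuously as halted. -/
theorem QTM.superposition_ne_zero_of_probBit {M : QTM} {ψ : M.Superposition}
    (h : probBit ψ true + probBit ψ false = 1) : ψ ≠ 0 := by
  rintro rfl
  simp [probBit] at h

/-- The machine determines the language: its halting time on `x` does not depend on the polynomial,
and the two outcomes, with probabilities summing to `1`, cannot both have probability at least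
`2/3`. -/
theorem countable_classBQP : ClassBQP.Countable := by
  choose M p _ hM using fun A : ClassBQP => A.2
  refine Set.countable_coe_iff.1 (Function.Injective.countable (f := M) fun A B hAB => ?_)
  ext x
  obtain ⟨T, -, hT, hsum, hin, hout⟩ := hM A x
  have hB' := hM B x
  rw [← hAB] at hB'
  obtain ⟨T', -, hT', hsum', hin', hout'⟩ := hB'
  obtain rfl : T = T' := le_antisymm
    (not_lt.1 (hT'.not_lt hT (QTM.superposition_ne_zero_of_probBit hsum')))
    (not_lt.1 (hT.not_lt hT' (QTM.superposition_ne_zero_of_probBit hsum)))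
  constructor
  · intro hx
    by_contra hx'
    linarith [hin hx, hout' hx']
  · intro hx
    by_contra hx'
    linarith [hin' hx, hout hx']

/-! ### Regular languages belong to the classical classes -/

theorem exists_equiv_fin_succ {σ : Type*} [Fintype σ] (a : σ) :
    ∃ (n : ℕ) (E : σ ≃ Fin (n + 1)), E a = 0 := by
  obtain ⟨n, hn⟩ := Nat.exists_eq_succ_of_ne_zero (Fintype.card_pos_iff.2 ⟨a⟩).ne'
  let E := Fintype.equivFinOfCardEq hn
  exact ⟨n, E.trans (Equiv.swap (E a) 0), by simp⟩

namespace TM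

open Classical in
/-- The machine that runs a finite automaton on its input tape. -/
noncomputable def ofDFA {n : ℕ} (D : DFA Bool (Fin (n + 1))) : TM where
  states := n
  symbols := 0
  accept := Finset.univ.filter (· ∈ D.accept)
  δ q b _ := b.elim ∅ fun b => {(D.step q b, none, 1, 0)}

variable {n : ℕ} (D : DFA Bool (Fin (n + 1)))

theorem ofDFA_deterministic : (ofDFA D).Deterministic := by
  rintro q (_ | b) s <;> simp [ofDFA]

/-- The configuration of `ofDFA D` on input `x` after `t` steps. -/
def dfaCfg (x : Str) (t : ℕ) : (ofDFA D).Cfg :=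
  ⟨D.eval (x.take t), t, fun _ => none, 0⟩

theorem inputCell_natCast (x : Str) (t : ℕ) : inputCell x t = x[t]? := by
  simp [inputCell]

theorem ofDFA_actions (x : Str) (t : ℕ) : (ofDFA D).actions x (dfaCfg D x t) =
    (x[t]?).elim ∅ fun b => {(D.step (D.eval (x.take t)) b, none, 1, 0)} := by
  rw [actions, dfaCfg, inputCell_natCast]
  rfl

theorem ofDFA_act {x : Str} {t : ℕ} (ht : t < x.length) :
    (ofDFA D).act x (dfaCfg D x t) (D.step (D.eval (x.take t)) x[t], none, 1, 0) =
      dfaCfg D x (t + 1) := by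
  ext1
  · change D.step (D.eval (x.take t)) x[t] = D.eval (x.take (t + 1))
    rw [List.take_add_one, List.getElem?_eq_getElem ht]
    exact (D.eval_append_singleton _ _).symm
  -- The confinement of the input head is inactive, as `t + 1 ≤ |x|`.
  · simp only [act, dfaCfg, SignType.coe_one]
    omega
  · exact Function.update_eq_self (0 : ℤ) fun _ => none
  · rfl

/-- There is no action on the blank after the input, so the run has exactly `|x|` steps. -/
theorem ofDFA_reachesIn (h0 : D.start = 0) (x : Str) (t : ℕ) (c : (ofDFA D).Cfg) :
    (ofDFA D).ReachesIn x t c ↔ t ≤ x.length ∧ c = dfaCfg D x t := by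
  induction t generalizing c with
  | zero =>
    simp only [ReachesIn, init, dfaCfg, List.take_zero, DFA.eval_nil, h0, zero_le, true_and]
    rfl
  | succ t ih =>
    simp only [ReachesIn, ih]
    constructor
    · rintro ⟨_, ⟨ht, rfl⟩, a, ha, rfl⟩
      rw [ofDFA_actions] at ha
      rcases ht.eq_or_lt with rfl | hlt
      · rw [List.getElem?_eq_none le_rfl] at ha
        exact absurd ha (Finset.notMem_empty a)
      · rw [List.getElem?_eq_getElem hlt] at ha
        obtain rfl := Finset.mem_singleton.1 ha
        exact ⟨hlt, ofDFA_act D hlt⟩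
    · rintro ⟨hlt, rfl⟩
      refine ⟨_, ⟨Nat.le_of_lt hlt, rfl⟩, _, ?_, (ofDFA_act D hlt).symm⟩
      rw [ofDFA_actions, List.getElem?_eq_getElem hlt]
      exact Finset.mem_singleton_self _

theorem ofDFA_halted_iff (x : Str) (t : ℕ) :
    (ofDFA D).Halted x (dfaCfg D x t) ↔ x.length ≤ t := by
  rw [Halted, ofDFA_actions]
  rcases lt_or_ge t x.length with h | h
  · rw [List.getElem?_eq_getElem h]
    exact iff_of_false (Finset.singleton_ne_empty _) (not_le.2 h)
  · rw [List.getElem?_eq_none h]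
    exact iff_of_true rfl h

theorem dfaCfg_accept_iff (x : Str) :
    (dfaCfg D x x.length).state ∈ (ofDFA D).accept ↔ x ∈ D.accepts := by
  simp only [ofDFA, dfaCfg, List.take_length]
  classical exact Finset.mem_filter.trans (and_iff_right (Finset.mem_univ _))

theorem language_ofDFA (h0 : D.start = 0) : (ofDFA D).language = D.accepts := by
  ext x
  constructor
  · rintro ⟨t, c, hr, hh, ha⟩
    obtain ⟨ht, rfl⟩ := (ofDFA_reachesIn D h0 x t c).1 hr
    obtain rfl := le_antisymm ht ((ofDFA_halted_iff D x t).1 hh)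
    exact (dfaCfg_accept_iff D x).1 ha
  · intro hx
    exact ⟨_, _, (ofDFA_reachesIn D h0 x _ _).2 ⟨le_rfl, rfl⟩, (ofDFA_halted_iff D x _).2 le_rfl,
      (dfaCfg_accept_iff D x).2 hx⟩

theorem ofDFA_haltsWithin (h0 : D.start = 0) (x : Str) : (ofDFA D).HaltsWithin x x.length :=
  fun t c h => ((ofDFA_reachesIn D h0 x t c).1 h).1

/-- The work head never moves, so even the bound `0` is met. -/
theorem ofDFA_spaceWithin (h0 : D.start = 0) (x : Str) (S : ℕ) : (ofDFA D).SpaceWithin x S := by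
  intro t c h
  rw [((ofDFA_reachesIn D h0 x t c).1 h).2]
  simp [dfaCfg]

end TM

theorem exists_ofDFA_of_isRegular {A : Language Bool} (hA : A.IsRegular) :
    ∃ (n : ℕ) (D : DFA Bool (Fin (n + 1))), D.start = 0 ∧ D.accepts = A := by
  obtain ⟨σ, _, D, rfl⟩ := hA
  obtain ⟨n, E, hE⟩ := exists_equiv_fin_succ D.start
  exact ⟨n, DFA.reindex E D, by simpa using hE, by simp⟩

theorem mem_DTIME_of_isRegular {A : Language Bool} (hA : A.IsRegular) {T : ℕ → ℕ}
    (hT : ∀ n, n ≤ T n) : A ∈ DTIME T := by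
  obtain ⟨n, D, h0, rfl⟩ := exists_ofDFA_of_isRegular hA
  exact ⟨TM.ofDFA D, TM.ofDFA_deterministic D,
    fun x t c h => (TM.ofDFA_haltsWithin D h0 x t c h).trans (hT _), TM.language_ofDFA D h0⟩

theorem mem_DSPACE_of_isRegular {A : Language Bool} (hA : A.IsRegular) (S : ℕ → ℕ) :
    A ∈ DSPACE S := by
  obtain ⟨n, D, h0, rfl⟩ := exists_ofDFA_of_isRegular hA
  exact ⟨TM.ofDFA D, TM.ofDFA_deterministic D,
    fun x => ⟨⟨_, TM.ofDFA_haltsWithin D h0 x⟩, TM.ofDFA_spaceWithin D h0 x _⟩,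
    TM.language_ofDFA D h0⟩

theorem DTIME_subset_NTIME (T : ℕ → ℕ) : DTIME T ⊆ NTIME T :=
  fun _ ⟨M, _, hM⟩ => ⟨M, hM⟩

theorem DSPACE_subset_NSPACE (S : ℕ → ℕ) : DSPACE S ⊆ NSPACE S :=
  fun _ ⟨M, _, hM⟩ => ⟨M, hM⟩

/-- Myhill–Nerode: every left quotient of `A` is a set of suffixes of words of `A`, and there are
only finitely many such sets. -/
theorem isRegular_of_finite {A : Language Bool} (hA : Set.Finite (A : Set Str)) :
    A.IsRegular := by
  refine Language.IsRegular.of_finite_range_leftQuotient ?_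
  have htails : (⋃ x ∈ (A : Set Str), {z : Str | z ∈ x.tails}).Finite :=
    hA.biUnion fun x _ => x.tails.finite_toSet
  refine htails.finite_subsets.subset ?_
  rintro _ ⟨w, rfl⟩ z hz
  exact Set.mem_biUnion hz (by simp)

theorem mem_classP_of_isRegular {A : Language Bool} (hA : A.IsRegular) : A ∈ ClassP :=
  Set.mem_iUnion.2 ⟨Polynomial.X, mem_DTIME_of_isRegular hA (by simp)⟩

theorem mem_classNP_of_isRegular {A : Language Bool} (hA : A.IsRegular) : A ∈ ClassNP :=
  Set.mem_iUnion.2 ⟨Polynomial.X, DTIME_subset_NTIME _ (mem_DTIME_of_isRegular hA (by simp))⟩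

theorem mem_classEXP_of_isRegular {A : Language Bool} (hA : A.IsRegular) : A ∈ ClassEXP :=
  Set.mem_iUnion.2 ⟨Polynomial.X, mem_DTIME_of_isRegular hA
    (by simpa using fun n => Nat.lt_two_pow_self.le)⟩

theorem mem_classCoNP_of_isRegular {A : Language Bool} (hA : A.IsRegular) : A ∈ ClassCoNP :=
  mem_classNP_of_isRegular hA.compl

theorem mem_classL_of_isRegular {A : Language Bool} (hA : A.IsRegular) : A ∈ ClassL :=
  Set.mem_iUnion.2 ⟨0, mem_DSPACE_of_isRegular hA _⟩

theorem mem_classNL_of_isRegular {A : Language Bool} (hA : A.IsRegular) : A ∈ ClassNL :=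
  Set.mem_iUnion.2 ⟨0, DSPACE_subset_NSPACE _ (mem_DSPACE_of_isRegular hA _)⟩

theorem mem_classPSPACE_of_isRegular {A : Language Bool} (hA : A.IsRegular) : A ∈ ClassPSPACE :=
  Set.mem_iUnion.2 ⟨0, mem_DSPACE_of_isRegular hA _⟩

/-- The code is self-delimiting: `1` announces a further bit and `0` the end. -/
theorem flatMap_bits_append_injective :
    Function.Injective fun w : Str => w.flatMap (fun b => [true, b]) ++ [false] := by
  intro v
  induction v with
  | nil => rintro (_ | ⟨b, w⟩) h <;> simp_all
  | cons a v ih =>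
    rintro (_ | ⟨b, w⟩) h
    · simp at h
    · simp only [List.flatMap_cons, List.cons_append, List.nil_append, List.cons.injEq,
        true_and] at h
      rw [h.1, ih h.2]

theorem mem_classPH_of_finite {A : Lang} (hA : A.Finite) : A ∈ ClassPH := by
  have hinj : Function.Injective fun y : Str => encodeTuple [y] := by
    simpa [encodeTuple] using flatMap_bits_append_injective
  -- With no quantifiers the relation is just the finite set of codes of members of `A`.
  refine ⟨0, 0, (fun y : Str => encodeTuple [y]) '' A,
    mem_classP_of_isRegular (isRegular_of_finite (hA.image _)), fun y => ?_⟩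
  exact (hinj.mem_set_image (s := A)).symm

/-! ### Computable amplitudes -/

namespace TM

/-- The machine that halts at once. -/
def idle : TM where
  states := 0
  symbols := 0
  accept := ∅
  δ _ _ _ := ∅

theorem idle_reachesIn {x : Str} {t : ℕ} {c : idle.Cfg} (h : idle.ReachesIn x t c) : t = 0 := by
  cases t with
  | zero => rfl
  | succ t =>
    obtain ⟨_, _, a, ha, -⟩ := h
    exact absurd ha (Finset.notMem_empty a)

theorem idle_outputs_nil (x : Str) : idle.Outputs x [] :=
  ⟨0, idle.init, rfl, rfl, fun _ _ => rfl⟩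

/-- The machine that writes `0` followed by as many ones as its input has digits. -/
def ones : TM where
  states := 1
  symbols := 0
  accept := ∅
  δ q b _ := if q = 0 then {(1, some (Sum.inl false), 0, 1)} else
    b.elim ∅ fun _ => {(1, some (Sum.inl true), 1, 1)}

theorem ones_deterministic : ones.Deterministic := by
  have h : ∀ (q : Fin 2) b s, (ones.δ q b s).card ≤ 1
    | 0, _, _ => (Finset.card_singleton _).le
    | 1, none, _ => Nat.zero_le 1
    | 1, some _, _ => (Finset.card_singleton _).le
  exact h

/-- The configuration of `ones` after `t + 1` steps. -/
def onesCfg (t : ℕ) : ones.Cfg :=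
  ⟨(1 : Fin 2), t, fun i => if 0 ≤ i ∧ i ≤ t then some (Sum.inl (decide (i ≠ 0))) else none, t + 1⟩

theorem ones_actions (x : Str) (t : ℕ) : ones.actions x (onesCfg t) =
    (x[t]?).elim ∅ fun _ => {((1 : Fin 2), some (Sum.inl true), 1, 1)} := by
  rw [actions, onesCfg, inputCell_natCast]
  rfl

theorem ones_act_init (x : Str) :
    ones.act x ones.init ((1 : Fin 2), some (Sum.inl false), 0, 1) = onesCfg 0 := by
  ext1
  · rfl
  · simp only [act, init, onesCfg, SignType.coe_zero]
    omega
  · funext i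
    simp only [act, init, onesCfg, Function.update_apply]
    by_cases h : i = 0
    · simp [h]
    · rw [if_neg h, if_neg (by push_cast; omega)]
  · simp [act, init, onesCfg]

theorem ones_act {x : Str} {t : ℕ} (ht : t < x.length) :
    ones.act x (onesCfg t) ((1 : Fin 2), some (Sum.inl true), 1, 1) = onesCfg (t + 1) := by
  ext1
  · rfl
  · simp only [act, onesCfg, SignType.coe_one]
    omega
  · funext i
    simp only [act, onesCfg, Function.update_apply]
    by_cases h : i = t + 1
    · rw [if_pos h, if_pos (by push_cast; omega), decide_eq_true (by omega)]
    · rw [if_neg h]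
      refine if_congr ?_ rfl rfl
      push_cast
      omega
  · simp [act, onesCfg]

/-- The shift by one is the first step, which writes the sign bit without moving the input head. -/
theorem ones_reachesIn_succ (x : Str) (t : ℕ) (c : ones.Cfg) :
    ones.ReachesIn x (t + 1) c ↔ t ≤ x.length ∧ c = onesCfg t := by
  induction t generalizing c with
  | zero =>
    constructor
    · rintro ⟨_, rfl, a, ha, rfl⟩
      obtain rfl := Finset.mem_singleton.1 ha
      exact ⟨Nat.zero_le _, ones_act_init x⟩
    · rintro ⟨-, rfl⟩
      exact ⟨_, rfl, _, Finset.mem_singleton_self _, (ones_act_init x).symm⟩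
  | succ t ih =>
    rw [ReachesIn]
    simp only [ih]
    constructor
    · rintro ⟨_, ⟨ht, rfl⟩, a, ha, rfl⟩
      rw [ones_actions] at ha
      rcases ht.eq_or_lt with rfl | hlt
      · rw [List.getElem?_eq_none le_rfl] at ha
        exact absurd ha (Finset.notMem_empty a)
      · rw [List.getElem?_eq_getElem hlt] at ha
        obtain rfl := Finset.mem_singleton.1 ha
        exact ⟨hlt, ones_act hlt⟩
    · rintro ⟨hlt, rfl⟩
      refine ⟨_, ⟨Nat.le_of_lt hlt, rfl⟩, _, ?_, (ones_act hlt).symm⟩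
      rw [ones_actions, List.getElem?_eq_getElem hlt]
      exact Finset.mem_singleton_self _

theorem ones_outputs (x : Str) : ones.Outputs x (false :: List.replicate x.length true) := by
  refine ⟨x.length + 1, onesCfg x.length, (ones_reachesIn_succ x _ _).2 ⟨le_rfl, rfl⟩, ?_, ?_⟩
  · rw [Halted, ones_actions, List.getElem?_eq_none le_rfl]
    rfl
  · rintro (_ | i) hi
    · simp [onesCfg]
    · simp only [onesCfg, List.getElem?_cons_succ, List.getElem?_replicate]
      simp only [List.length_cons, List.length_replicate] at hi
      by_cases h : i < x.length
      · rw [if_pos (by push_cast; omega), if_pos h, decide_eq_true (by omega)]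
        rfl
      · rw [if_neg (by push_cast; omega), if_neg h]
        rfl

end TM

theorem strToInt_ones (n : ℕ) : strToInt (false :: List.replicate n true) = 2 ^ n - 1 := by
  have h : Nat.ofDigits 2 (List.replicate n 1) + 1 = 2 ^ n := by
    induction n with
    | zero => simp
    | succ n ih =>
      rw [List.replicate_succ, Nat.ofDigits_cons, pow_succ, ← ih]
      ring
  have h' : (Nat.ofDigits 2 (List.replicate n 1) : ℤ) + 1 = 2 ^ n := by exact_mod_cast h
  simp [strToInt]
  linarith

theorem polyTimeReal_zero : PolyTimeReal 0 := by
  refine ⟨TM.idle, 0, fun _ _ _ => Nat.zero_le 1, fun x t c h => (TM.idle_reachesIn h).le.trans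
    (Nat.zero_le _), fun n => ⟨[], TM.idle_outputs_nil _, ?_⟩⟩
  simp [strToInt]

/-- The numerator `2 ^ n - 1` has error exactly `1 / 2 ^ n`, which is allowed, and its binary digits
are all ones, so the input can be copied after a sign bit. -/
theorem polyTimeReal_one : PolyTimeReal 1 := by
  refine ⟨TM.ones, Polynomial.X + 1, TM.ones_deterministic, ?_, fun n =>
    ⟨_, TM.ones_outputs _, ?_⟩⟩
  · rintro x (_ | t) c h
    · exact Nat.zero_le _
    · simpa using ((TM.ones_reachesIn_succ x t c).1 h).1
  · rw [List.length_replicate, strToInt_ones]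
    have h : (0 : ℝ) < 2 ^ n := by positivity
    push_cast
    rw [show (1 : ℝ) - (2 ^ n - 1) / 2 ^ n = 1 / 2 ^ n by field_simp; ring, abs_of_pos (by positivity)]

theorem polyTimeComplex_ite (p : Prop) [Decidable p] : PolyTimeComplex (if p then 1 else 0) := by
  split_ifs
  · exact ⟨polyTimeReal_one, polyTimeReal_zero⟩
  · exact ⟨polyTimeReal_zero, polyTimeReal_zero⟩

/-! ### Reversible machines as quantum Turing machines -/

namespace QTM

/-- The machine with classical transition table `π` followed by a move of the head whose direction
depends on the new state only. -/
noncomputable def ofPerm {n m : ℕ} (π : Equiv.Perm (Fin (n + 2) × Sym m))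
    (d : Fin (n + 2) → ℤˣ) : QTM where
  states := n
  symbols := m
  δ q s a := if ((π (q, s)).1, (π (q, s)).2, d (π (q, s)).1) = a then 1 else 0
  efficient _ _ _ := polyTimeComplex_ite _

variable {n m : ℕ} (π : Equiv.Perm (Fin (n + 2) × Sym m)) (d : Fin (n + 2) → ℤˣ)

/-- The successor of a configuration of `ofPerm π d`. -/
noncomputable def next (c : (ofPerm π d).Cfg) : (ofPerm π d).Cfg :=
  (ofPerm π d).act c ((π (c.state, c.tape.1 c.pos)).1, (π (c.state, c.tape.1 c.pos)).2,
    d (π (c.state, c.tape.1 c.pos)).1)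

/-- Since the move depends only on the new state, the new state tells where the head was; there, `π`
can be inverted to recover the old state and symbol. -/
theorem next_bijective : Function.Bijective (next π d) := by
  constructor
  · rintro ⟨q, t, p⟩ ⟨q', t', p'⟩ h
    rw [Cfg.ext_iff] at h
    obtain ⟨h1, h2, h3⟩ := h
    change (π (q, t.1 p)).1 = (π (q', t'.1 p')).1 at h1
    change p + (d (π (q, t.1 p)).1 : ℤ) = p' + (d (π (q', t'.1 p')).1 : ℤ) at h3
    have h4 : Function.update t.1 p (π (q, t.1 p)).2 =
        Function.update t'.1 p' (π (q', t'.1 p')).2 := congrArg Subtype.val h2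
    obtain rfl : p = p' := by rw [h1] at h3; exact add_right_cancel h3
    have h5 : (π (q, t.1 p)).2 = (π (q', t'.1 p)).2 :=
      (Function.update_self p ..).symm.trans ((congrFun h4 p).trans (Function.update_self ..))
    have h6 : (q, t.1 p) = (q', t'.1 p) := π.injective (Prod.ext h1 h5)
    rw [Prod.mk.injEq] at h6
    obtain ⟨rfl, h7⟩ := h6
    have : t = t' := by
      refine Subtype.ext (funext fun i => ?_)
      by_cases hi : i = p
      · rw [hi, h7]
      · exact (Function.update_of_ne hi ..).symm.trans
          ((congrFun h4 i).trans (Function.update_of_ne hi ..))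
    rw [this]
  · rintro ⟨q, t, p⟩
    let p' : ℤ := p - d q
    let r : Fin (n + 2) × Sym m := π.symm (q, t.1 p')
    have hw : (t.write p' r.2).1 p' = r.2 := Function.update_self ..
    have hr : π (r.1, (t.write p' r.2).1 p') = (q, t.1 p') := by
      rw [hw]
      exact π.apply_symm_apply _
    refine ⟨⟨r.1, t.write p' r.2, p'⟩, ?_⟩
    change (⟨(π (r.1, (t.write p' r.2).1 p')).1,
      (t.write p' r.2).write p' (π (r.1, (t.write p' r.2).1 p')).2,
      p' + (d (π (r.1, (t.write p' r.2).1 p')).1 : ℤ)⟩ : (ofPerm π d).Cfg) = _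
    rw [hr]
    ext1
    · rfl
    · refine Subtype.ext ?_
      change Function.update (Function.update t.1 p' r.2) p' (t.1 p') = t.1
      exact (Function.update_idem ..).trans (Function.update_eq_self ..)
    · exact sub_add_cancel _ _

theorem evolve_ofPerm : (ofPerm π d).evolve = Finsupp.lmapDomain ℂ ℂ (next π d) := by
  refine Finsupp.lhom_ext fun c z => ?_
  rw [evolve, Finsupp.linearCombination_single, Finsupp.lmapDomain_apply,
    Finsupp.mapDomain_single]
  have hsum : ∑ a, Finsupp.single ((ofPerm π d).act c a)
      ((ofPerm π d).δ c.state (c.tape.1 c.pos) a) = Finsupp.single (next π d c) 1 := by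
    refine (Finset.sum_eq_single ((π (c.state, c.tape.1 c.pos)).1,
      (π (c.state, c.tape.1 c.pos)).2, d (π (c.state, c.tape.1 c.pos)).1) ?_ ?_).trans ?_
    · intro a _ ha
      simp only [ofPerm]
      rw [if_neg (Ne.symm ha), Finsupp.single_zero]
      rfl
    · exact fun h => absurd (Finset.mem_univ _) h
    · simp only [ofPerm, next, if_true]
  rw [hsum, Finsupp.smul_single, smul_eq_mul, mul_one]

/-- Evolution permutes the basis of configurations. -/
theorem unitary_ofPerm : (ofPerm π d).Unitary := by
  have hb := next_bijective π d
  rw [Unitary, evolve_ofPerm]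
  refine ⟨fun ψ => ?_, fun ψ => ?_⟩
  · classical
    rw [normSq, normSq, Finsupp.lmapDomain_apply, Finsupp.mapDomain_support_of_injective hb.1,
      Finset.sum_image hb.1.injOn]
    simp [Finsupp.mapDomain_apply hb.1]
  · exact Finsupp.mapDomain_surjective hb.2 ψ

/-- The configuration of `ofPerm π d` on input `x` after `t` steps. -/
noncomputable def run (x : Str) (t : ℕ) : (ofPerm π d).Cfg :=
  (next π d)^[t] ⟨(0 : Fin (n + 2)), Tape.ofStr x, 0⟩

theorem run_succ (x : Str) (t : ℕ) : run π d x (t + 1) = next π d (run π d x t) :=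
  Function.iterate_succ_apply' ..

theorem superposition_ofPerm (x : Str) (t : ℕ) :
    (ofPerm π d).superposition x t = Finsupp.single (run π d x t) 1 := by
  induction t with
  | zero => rfl
  | succ t ih =>
    rw [superposition, Function.iterate_succ_apply', ← superposition, ih, evolve_ofPerm,
      Finsupp.lmapDomain_apply, Finsupp.mapDomain_single, run_succ]

theorem haltsIn_ofPerm {x : Str} {T : ℕ} (hT : (run π d x T).state = (1 : Fin (n + 2)))
    (hlt : ∀ t < T, (run π d x t).state ≠ (1 : Fin (n + 2))) : (ofPerm π d).HaltsIn x T := by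
  simp only [HaltsIn, superposition_ofPerm]
  refine ⟨fun c hc => ?_, fun t ht c hc => ?_⟩
  · obtain rfl := Finset.mem_singleton.1 (Finsupp.support_single_subset hc)
    exact hT
  · obtain rfl := Finset.mem_singleton.1 (Finsupp.support_single_subset hc)
    exact hlt t ht

theorem probBit_single {M : QTM} {c : M.Cfg} {b : Bool} (h : c.tape.1 0 = some (Sum.inl b))
    (b' : Bool) : probBit (Finsupp.single c 1 : M.Superposition) b' = if b' = b then 1 else 0 := by
  classical
  rw [probBit, Finsupp.support_single _ one_ne_zero, Finset.filter_singleton, h]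
  by_cases hb : b' = b
  · simp [hb]
  · simp [hb, Ne.symm hb]

/-- A language is in `BQP` if a reversible machine decides it in constant time. -/
theorem mem_classBQP_of_run {A : Lang} (T : ℕ) (b : Str → Bool) (hb : ∀ x, b x = true ↔ x ∈ A)
    (hT : ∀ x, (run π d x T).state = (1 : Fin (n + 2)))
    (hlt : ∀ x, ∀ t < T, (run π d x t).state ≠ (1 : Fin (n + 2)))
    (hbit : ∀ x, (run π d x T).tape.1 0 = some (Sum.inl (b x))) : A ∈ ClassBQP := by
  refine ⟨ofPerm π d, Polynomial.C T, unitary_ofPerm π d, fun x => ⟨T, by simp,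
    haltsIn_ofPerm π d (hT x) (hlt x), ?_⟩⟩
  rw [superposition_ofPerm, probBit_single (hbit x), probBit_single (hbit x), ← hb]
  cases b x <;> norm_num

end QTM

/-! ### Finite languages belong to `BQP` -/

/-- On a finite set a partial injection extends to a permutation. Thus a reversible machine need
only be specified, injectively, on the transitions that matter. -/
theorem exists_perm_apply_eq {α ι : Type*} [Fintype α] {u v : ι → α}
    (hu : Function.Injective u) (hv : Function.Injective v) :
    ∃ π : Equiv.Perm α, ∀ i, π (u i) = v i := by
  classical
  let E : {a // a ∈ Set.range u} ≃ {a // a ∈ Set.range v} :=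
    (Equiv.ofInjective u hu).symm.trans (Equiv.ofInjective v hv)
  refine ⟨E.extendSubtype, fun i => ?_⟩
  rw [Equiv.extendSubtype_apply_of_mem E (u i) ⟨i, rfl⟩]
  simp only [E, Equiv.trans_apply]
  have : (Equiv.ofInjective u hu).symm ⟨u i, ⟨i, rfl⟩⟩ = i :=
    (Equiv.ofInjective u hu).symm_apply_apply i
  rw [this]
  rfl

theorem exists_equiv_fin_add_two {σ : Type*} [Fintype σ] {a b : σ} (hab : a ≠ b) :
    ∃ (n : ℕ) (E : σ ≃ Fin (n + 2)), E a = 0 ∧ E b = 1 := by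
  have : Nontrivial σ := ⟨⟨a, b, hab⟩⟩
  obtain ⟨n, hn⟩ := Nat.exists_eq_add_of_le' (Fintype.one_lt_card (α := σ))
  let E : σ ≃ Fin (n + 2) := Fintype.equivFinOfCardEq hn
  let E' := E.trans (Equiv.swap (E a) 0)
  have ha : E' a = 0 := by simp [E']
  have hb : (0 : Fin (n + 2)) ≠ E' b := fun h => hab (E'.injective (ha.trans h))
  refine ⟨n, E'.trans (Equiv.swap (E' b) 1), ?_, by simp⟩
  rw [Equiv.trans_apply, ha, Equiv.swap_apply_of_ne_of_ne hb (by simp)]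

/-! ### The scanning machine -/

/-- Words of length less than `j` over the alphabet of bits and the blank. -/
abbrev ShortWord (j : ℕ) := {w : List (Option Bool) // w.length < j}

noncomputable instance (j : ℕ) : Fintype (ShortWord j) :=
  (List.finite_length_lt (Option Bool) j).fintype

/-- The first `t` cells of the tape with input `x`. -/
def window (x : Str) (t : ℕ) : List (Option Bool) :=
  (List.range t).map fun i => x[i]?

theorem length_window (x : Str) (t : ℕ) : (window x t).length = t := by
  simp [window]

theorem window_succ (x : Str) (t : ℕ) : window x (t + 1) = window x t ++ [x[t]?] := by
  simp [window, List.range_succ]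

/-- A window longer than `x` shows the blank that ends `x`, so `y` ends no later. -/
theorem eq_of_window_eq {x y : Str} {t : ℕ} (hx : x.length < t) (h : window x t = window y t) :
    x = y := by
  have hget : ∀ i < t, x[i]? = y[i]? := by
    intro i hi
    have := congrArg (·[i]?) h
    simpa [window, hi] using this
  have hle : y.length ≤ x.length := by
    rw [← List.getElem?_eq_none_iff, ← hget _ hx]
    simp
  refine List.ext_getElem? fun i => ?_
  rcases lt_or_ge i t with hi | hi
  · exact hget i hi
  · rw [List.getElem?_eq_none (by omega), List.getElem?_eq_none (by omega)]

/-- The states of a machine that moves its first `k + 2` cells into its state, leaves a code of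
them in cell `k + 1`, and returns to cell `0` with one bit of information. -/
abbrev ScanState (k : ℕ) := Option (ShortWord (k + 2) ⊕ Bool × Fin (k + 1))

/-- The transitions of the scanning machine. -/
abbrev ScanRule (k : ℕ) := ShortWord (k + 2) × Option Bool ⊕ Bool × Fin (k + 1)

namespace ScanRule

variable {k m : ℕ}

/-- State and symbol to which a transition applies. -/
def source : ScanRule k → ScanState k × Sym m
  | Sum.inl (w, s) => (some (Sum.inl w), s.map Sum.inl)
  | Sum.inr (b, j) => (some (Sum.inr (b, j)), none)

/-- State and symbol that result from a transition. -/
def target (f : List (Option Bool) → Bool) (code : ShortWord (k + 3) ≃ Fin m) :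
    ScanRule k → ScanState k × Sym m
  | Sum.inl (w, s) =>
    if h : (w.1 ++ [s]).length < k + 2 then (some (Sum.inl ⟨w.1 ++ [s], h⟩), none)
    else (some (Sum.inr (f (w.1 ++ [s]), Fin.last k)),
      some (Sum.inr (code ⟨w.1 ++ [s], by simpa using w.2⟩)))
  | Sum.inr (b, j) =>
    if h : (j : ℕ) = 0 then (none, some (Sum.inl b))
    else (some (Sum.inr (b, ⟨j - 1, by omega⟩)), none)

theorem source_injective : Function.Injective (source (k := k) (m := m)) := by
  rintro (⟨w, s⟩ | ⟨b, j⟩) (⟨w', s'⟩ | ⟨b', j'⟩) h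
  · simp only [source, Prod.mk.injEq, Option.some.injEq, Sum.inl.injEq] at h
    rw [h.1, Option.map_injective Sum.inl_injective h.2]
  · simp [source] at h
  · simp [source] at h
  · simpa [source] using h

/-- Nothing is forgotten: while scanning, the state holds the erased symbols. The last scanning step
reduces the state to one bit but leaves the code of the whole window on the tape. That code symbol
separates this step from the returning ones, which leave a blank or, on halting, a bit. -/
theorem target_injective (f : List (Option Bool) → Bool) (code : ShortWord (k + 3) ≃ Fin m) :
    Function.Injective (target f code) := by
  rintro (⟨⟨w, hw⟩, s⟩ | ⟨b, j⟩) (⟨⟨w', hw'⟩, s'⟩ | ⟨b', j'⟩) h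
  · simp only [target] at h
    have hww : w ++ [s] = w' ++ [s'] := by
      split_ifs at h <;> simp_all
    have := List.append_inj' hww rfl
    simp_all
  · simp only [target] at h
    split_ifs at h <;> simp_all
  · simp only [target] at h
    split_ifs at h <;> simp_all
  · simp only [target] at h
    split_ifs at h with h1 h2 h2
    · simp only [Prod.mk.injEq, Option.some.injEq, Sum.inl.injEq, true_and] at h
      rw [h, Fin.ext (h1.trans h2.symm)]
    · simp at h
    · simp at h
    · simp only [Prod.mk.injEq, Option.some.injEq, Sum.inr.injEq, Fin.mk.injEq, and_true] at h
      rw [h.1, Fin.ext (by omega : (j : ℕ) = j')]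

end ScanRule

/-- The head moves right while the input is being scanned, and left afterwards. -/
def scanMove {k : ℕ} : ScanState k → ℤˣ
  | some (Sum.inl _) => 1
  | _ => -1

/-- The move of the head on entering a state, when the states are numbered by `E`. -/
def scanDir {k n : ℕ} (E : ScanState k ≃ Fin (n + 2)) (q : Fin (n + 2)) : ℤˣ :=
  scanMove (E.symm q)

section Scan

variable {k n m : ℕ} {f : List (Option Bool) → Bool} {code : ShortWord (k + 3) ≃ Fin m}
  {E : ScanState k ≃ Fin (n + 2)} {π : Equiv.Perm (Fin (n + 2) × Sym m)}

/-- A transition of the scanning machine, applied to a configuration. -/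
theorem next_of_rule (hπ : ∀ r : ScanRule k, π (Prod.map E id r.source) =
      Prod.map E id (r.target f code))
    {c : (QTM.ofPerm π (scanDir E)).Cfg} (r : ScanRule k) {q q' : ScanState k} {s s' : Sym m}
    {p : ℤ} (hsrc : r.source = (q, s)) (htgt : r.target f code = (q', s'))
    (hq : c.state = E q) (hp : c.pos = p) (hs : c.tape.1 p = s) :
    (QTM.next π (scanDir E) c).state = E q' ∧
      (QTM.next π (scanDir E) c).pos = p + (scanMove q' : ℤ) ∧
      (QTM.next π (scanDir E) c).tape.1 p = s' ∧
      ∀ i ≠ p, (QTM.next π (scanDir E) c).tape.1 i = c.tape.1 i := by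
  subst hp
  have h : π (c.state, c.tape.1 c.pos) = (E q', s') := by
    have := hπ r
    rw [hsrc, htgt] at this
    exact (congrArg π (Prod.ext hq hs)).trans this
  have hnext : QTM.next π (scanDir E) c =
      (QTM.ofPerm π (scanDir E)).act c (E q', s', scanDir E (E q')) :=
    congrArg (fun z : Fin (n + 2) × Sym m =>
      (QTM.ofPerm π (scanDir E)).act c (z.1, z.2, scanDir E z.1)) h
  rw [hnext]
  refine ⟨rfl, ?_, Function.update_self .., fun i hi => Function.update_of_ne hi ..⟩
  change c.pos + (scanMove (E.symm (E q')) : ℤ) = _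
  rw [E.symm_apply_apply]

theorem run_scan (hE : E (some (Sum.inl ⟨[], by simp⟩)) = 0)
    (hπ : ∀ r : ScanRule k, π (Prod.map E id r.source) = Prod.map E id (r.target f code))
    (x : Str) (t : ℕ) (ht : t < k + 2) :
    (QTM.run π (scanDir E) x t).state =
        E (some (Sum.inl ⟨window x t, by rwa [length_window]⟩)) ∧
      (QTM.run π (scanDir E) x t).pos = t ∧
      (∀ i : ℕ, i < t → (QTM.run π (scanDir E) x t).tape.1 i = none) ∧
      ∀ i : ℕ, t ≤ i → (QTM.run π (scanDir E) x t).tape.1 i = (x[i]?).map Sum.inl := by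
  induction t with
  | zero =>
    refine ⟨hE.symm, rfl, fun i hi => absurd hi i.not_lt_zero, fun i _ => ?_⟩
    exact congrArg (Option.map Sum.inl) (TM.inputCell_natCast x i)
  | succ t ih =>
    obtain ⟨h1, h2, h3, h4⟩ := ih (by omega)
    have hw : (window x t ++ [x[t]?]).length < k + 2 := by
      rwa [← window_succ, length_window]
    obtain ⟨g1, g2, g3, g4⟩ := next_of_rule hπ
      (Sum.inl (⟨window x t, by rw [length_window]; omega⟩, x[t]?)) rfl (dif_pos hw) h1 h2
      (h4 t le_rfl)
    rw [QTM.run_succ]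
    refine ⟨?_, ?_, fun i hi => ?_, fun i hi => ?_⟩
    · simpa only [window_succ] using g1
    · rw [g2]
      simp [scanMove]
    · rcases (Nat.lt_succ_iff.1 hi).eq_or_lt with rfl | hlt
      · exact g3
      · rw [g4 _ (by exact_mod_cast hlt.ne), h3 i hlt]
    · rw [g4 _ (by exact_mod_cast (Nat.lt_of_succ_le hi).ne'), h4 i (by omega)]

/-- Here `k + 2` steps scan, the last one turning back from cell `k + 1` to cell `k`; after `j`
further steps the head is on cell `k - j`. The cells `0, …, k` stay blank, as the returning
transitions require. -/
theorem run_return (hE : E (some (Sum.inl ⟨[], by simp⟩)) = 0)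
    (hπ : ∀ r : ScanRule k, π (Prod.map E id r.source) = Prod.map E id (r.target f code))
    (x : Str) (j : ℕ) (i : Fin (k + 1)) (hij : i + j = k) :
    (QTM.run π (scanDir E) x (k + 2 + j)).state =
        E (some (Sum.inr (f (window x (k + 2)), i))) ∧
      (QTM.run π (scanDir E) x (k + 2 + j)).pos = (i : ℕ) ∧
      ∀ l : ℕ, l < k + 1 → (QTM.run π (scanDir E) x (k + 2 + j)).tape.1 l = none := by
  induction j generalizing i with
  | zero =>
    obtain ⟨h1, h2, h3, h4⟩ := run_scan hE hπ x (k + 1) (by omega)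
    have hw : ¬ (window x (k + 1) ++ [x[k + 1]?]).length < k + 2 := by
      rw [← window_succ, length_window]
      omega
    obtain ⟨g1, g2, -, g4⟩ := next_of_rule hπ
      (Sum.inl (⟨window x (k + 1), by rw [length_window]; omega⟩, x[k + 1]?)) rfl (dif_neg hw)
      h1 h2 (h4 _ le_rfl)
    obtain rfl : i = Fin.last k := Fin.ext hij
    rw [← window_succ, ← QTM.run_succ] at g1
    rw [← QTM.run_succ] at g2 g4
    refine ⟨g1, g2.trans ?_, fun l hl => (g4 _ ?_).trans (h3 l hl)⟩
    · simp [scanMove]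
    · exact_mod_cast hl.ne
  | succ j ih =>
    have hi : (i : ℕ) + 1 < k + 1 := by omega
    obtain ⟨h1, h2, h3⟩ := ih ⟨i + 1, hi⟩ (by simp only; omega)
    have htgt : ScanRule.target f code (Sum.inr (f (window x (k + 2)), ⟨i + 1, hi⟩)) =
        (some (Sum.inr (f (window x (k + 2)), i)), none) := by
      simp [ScanRule.target]
    obtain ⟨g1, g2, g3, g4⟩ := next_of_rule hπ
      (Sum.inr (f (window x (k + 2)), ⟨i + 1, hi⟩)) rfl htgt h1 h2 (h3 _ hi)
    rw [← QTM.run_succ] at g1 g2 g3 g4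
    refine ⟨g1, g2.trans ?_, fun l hl => ?_⟩
    · simp [scanMove]
    · by_cases hl' : l = i + 1
      · subst hl'
        exact g3
      · exact (g4 _ (by exact_mod_cast hl')).trans (h3 l hl)

theorem run_answer (hE : E (some (Sum.inl ⟨[], by simp⟩)) = 0)
    (hπ : ∀ r : ScanRule k, π (Prod.map E id r.source) = Prod.map E id (r.target f code))
    (x : Str) :
    (QTM.run π (scanDir E) x (k + 2 + k + 1)).state = E none ∧
      (QTM.run π (scanDir E) x (k + 2 + k + 1)).tape.1 0 =
        some (Sum.inl (f (window x (k + 2)))) := by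
  obtain ⟨h1, h2, h3⟩ := run_return hE hπ x k 0 (by simp)
  have htgt : ScanRule.target f code (Sum.inr (f (window x (k + 2)), 0)) =
      (none, some (Sum.inl (f (window x (k + 2))))) := by
    simp [ScanRule.target]
  obtain ⟨g1, -, g3, -⟩ := next_of_rule hπ (Sum.inr (f (window x (k + 2)), 0)) rfl htgt h1 h2
    (h3 _ (by simp))
  rw [QTM.run_succ]
  exact ⟨g1, g3⟩

end Scan

theorem mem_classBQP_of_finite {A : Lang} (hA : A.Finite) : A ∈ ClassBQP := by
  classical
  -- A window of `k + 2` cells is longer than every word of `A`, so it decides membership.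
  obtain ⟨k, hk⟩ : ∃ k, ∀ x ∈ A, x.length < k + 2 := by
    obtain ⟨k, hk⟩ := (hA.image List.length).bddAbove
    exact ⟨k, fun x hx => (hk ⟨x, hx, rfl⟩).trans_lt (by omega)⟩
  let f : List (Option Bool) → Bool := fun w => decide (∃ x ∈ A, window x (k + 2) = w)
  have hf : ∀ x, f (window x (k + 2)) = true ↔ x ∈ A := by
    intro x
    simp only [f, decide_eq_true_eq]
    refine ⟨?_, fun hx => ⟨x, hx, rfl⟩⟩
    rintro ⟨y, hy, hyx⟩
    rwa [← eq_of_window_eq (hk y hy) hyx]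
  obtain ⟨n, E, hE, hE'⟩ := exists_equiv_fin_add_two (σ := ScanState k)
    (a := some (Sum.inl ⟨[], by simp⟩)) (b := none) (by simp)
  let code := Fintype.equivFin (ShortWord (k + 3))
  have hinj : Function.Injective (Prod.map E (id : Sym (Fintype.card (ShortWord (k + 3))) → _)) :=
    E.injective.prodMap Function.injective_id
  obtain ⟨π, hπ⟩ := exists_perm_apply_eq (hinj.comp ScanRule.source_injective)
    (hinj.comp (ScanRule.target_injective f code))
  -- The running time is the same for all inputs: `k + 2` scanning steps, `k` steps back to cell
  -- `0`, and one that writes the answer.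
  refine QTM.mem_classBQP_of_run π (scanDir E) (k + 2 + k + 1) _ hf
    (fun x => (run_answer hE hπ x).1.trans hE') (fun x t ht => ?_)
    fun x => (run_answer hE hπ x).2
  rw [← hE']
  rcases lt_or_ge t (k + 2) with hlt | hge
  · rw [(run_scan hE hπ x t hlt).1]
    exact E.injective.ne (by simp)
  · obtain ⟨j, rfl⟩ := Nat.exists_eq_add_of_le hge
    rw [(run_return hE hπ x j ⟨k - j, by omega⟩ (by simp only; omega)).1]
    exact E.injective.ne (by simp)

end Complexity

theorem mainTheorem12 (e : ℕ ≃ Complexity.Str) :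
    Complexity.IsSigma02Complete (Complexity.asSubset e Complexity.ClassP) ∧
    Complexity.IsSigma02Complete (Complexity.asSubset e Complexity.ClassNP) ∧
    Complexity.IsSigma02Complete (Complexity.asSubset e Complexity.ClassEXP) ∧
    Complexity.IsSigma02Complete (Complexity.asSubset e Complexity.ClassCoNP) ∧
    Complexity.IsSigma02Complete (Complexity.asSubset e Complexity.ClassBQP) ∧
    Complexity.IsSigma02Complete (Complexity.asSubset e Complexity.ClassPH) ∧
    Complexity.IsSigma02Complete (Complexity.asSubset e Complexity.ClassL) ∧
    Complexity.IsSigma02Complete (Complexity.asSubset e Complexity.ClassNL) ∧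
    Complexity.IsSigma02Complete (Complexity.asSubset e Complexity.ClassPSPACE) := by
  open Complexity in
  exact ⟨isSigma02Complete_asSubset e countable_classP fun _ hA =>
      mem_classP_of_isRegular (isRegular_of_finite hA),
    isSigma02Complete_asSubset e countable_classNP fun _ hA =>
      mem_classNP_of_isRegular (isRegular_of_finite hA),
    isSigma02Complete_asSubset e countable_classEXP fun _ hA =>
      mem_classEXP_of_isRegular (isRegular_of_finite hA),
    isSigma02Complete_asSubset e countable_classCoNP fun _ hA =>
      mem_classCoNP_of_isRegular (isRegular_of_finite hA),
    isSigma02Complete_asSubset e countable_classBQP fun _ hA => mem_classBQP_of_finite hA,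
    isSigma02Complete_asSubset e countable_classPH fun _ hA => mem_classPH_of_finite hA,
    isSigma02Complete_asSubset e countable_classL fun _ hA =>
      mem_classL_of_isRegular (isRegular_of_finite hA),
    isSigma02Complete_asSubset e countable_classNL fun _ hA =>
      mem_classNL_of_isRegular (isRegular_of_finite hA),
    isSigma02Complete_asSubset e countable_classPSPACE fun _ hA =>
      mem_classPSPACE_of_isRegular (isRegular_of_finite hA)⟩
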